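/- Let $d\ge 1$, $\mathbb{T}^2=\mathbb{R}^2/\mathbb{Z}^2$ and $\mathbb{T}^2_d=\mathbb{R}^2/d\mathbb{Z}^2$. For $v\in\mathbb{R}^2$ let $\#^d_v\mathbb{T}^2$ be the translation surface obtained from $d$ copies of $\mathbb{T}^2$, numbered by $\mathbb{Z}/d\mathbb{Z}$, by slitting each along the projection of the segment $[0,v]$ and gluing opposite edges of the slits so that each crossing of the segment from left to right leads from sheet $j$ to sheet $j+1$ (crossings are counted with multiplicity if the projected segment overlaps or crosses itself). Its one-form is the pull-back of $dz$, the points over $[0]$ and $[v]$ are its (possibly degenerate) cone points, and up to isomorphism it depends only on $[v]\in\mathbb{T}^2_d$. The group $\mathbb{Z}/d\mathbb{Z}$ acts on it by moving the sheets. A cylinder in direction $\theta$ is an open subset, not containing cone points, isometric to some $\mathbb{R}/w\mathbb{Z}\times(0,h)$ and foliated by closed geodesics in direction $\theta$. The direction $\theta$ is periodic if the surface minus its cone points is the union of the closures of the maximal cylinders in direction $\theta$. It is simple if it is periodic and any two maximal cylinders in direction $\theta$ are mapped to each other by an element of $\mathbb{Z}/d\mathbb{Z}$. For $i\in\mathbb{Z}/d\mathbb{Z}$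 let $\mathscr{C}_i\subset\mathbb{T}^2_d$ be the open horizontal cylinder of the points whose second coordinate lies strictly between $i$ and $i+1$ (mod $d$); its top boundary $\partial^{top}\mathscr{C}_i$ is the set of the points with second coordinate $i+1$ (mod $d$). Write $(m,d)$ for the greatest common divisor, with $(0,d)=d$. **Theorem.** Let $v\in\mathbb{R}^2$ and let $k$ be a natural number. The following are equivalent: 1. $\#^d_v\mathbb{T}^2$ has a simple direction with exactly $k$ maximal cylinders. 2. There are $A\in \mathrm{SL}_2(\mathbb{Z})$ and $m\in\mathbb{Z}/d\mathbb{Z}$ with $[A\cdot v]\in\partial^{top}\mathscr{C}_{m-1}$ (that is, the second coordinate of $A\cdot v$ is an integer congruent to $m$ modulo $d$) and $k=(m,d)$. (In particular such a $k$ divides $d$.) If moreover $[v]$ is a torsion point of $\mathbb{T}^2_d$, these are also equivalent to: 3. There are $m\in\mathbb{Z}/d\mathbb{Z}$ with $k=(m,d)$ and a positive integer $n$ such that $\frac{d}{(d,m)}$ divides $n$ and $[v]$ has order exactly $n$ in $\mathbb{T}^2_d$. -/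

import Mathlib

open Set Filter Topology

namespace DSym

/-- The lattice `dℤ²` in the plane `ℝ²`. -/
def lattice (d : ℕ) : AddSubgroup (Fin 2 → ℝ) where
  carrier := {z | ∃ a : Fin 2 → ℤ, ∀ i, z i = (d : ℝ) * (a i : ℝ)}
  zero_mem' := ⟨0, fun i => by simp⟩
  add_mem' := by
    rintro x y ⟨a, ha⟩ ⟨b, hb⟩
    exact ⟨a + b, fun i => by simp [ha i, hb i, mul_add]⟩
  neg_mem' := by
    rintro x ⟨a, ha⟩
    exact ⟨-a, fun i => by simp [ha i]⟩

/-- The torus `𝕋²_d = ℝ²/dℤ²`; `Torus 1` is the standard torus `𝕋²`. -/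
abbrev Torus (d : ℕ) : Type := (Fin 2 → ℝ) ⧸ lattice d

/-- The class `[z] ∈ 𝕋²_d` of a vector `z`. -/
abbrev toTorus (d : ℕ) (z : Fin 2 → ℝ) : Torus d := QuotientAddGroup.mk z

/-- `det (v, w)`: positive when `w` points to the left of `v`, negative when to the right. -/
def det2 (v w : Fin 2 → ℝ) : ℝ := v 0 * w 1 - v 1 * w 0

/-- How many times the projection to `𝕋²` of the open segment from `0` to `v` runs through `p`. -/
noncomputable def passages (v : Fin 2 → ℝ) (p : Torus 1) : ℕ :=
  {s : ℝ | s ∈ Ioo (0 : ℝ) 1 ∧ toTorus 1 (s • v) = p}.ncard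

/-- The change of sheet in a short step from `z₀` to `z`. All slits through `z₀` are parallel to
`v`; a step that leaves them to their right crosses each of them once, and every crossing from the
left to the right raises the sheet number by one. A point on the slit is counted as a point of the
left edge of the slit. -/
noncomputable def sheetJump (v z₀ z : Fin 2 → ℝ) : ℕ :=
  open Classical in if det2 v (z - z₀) < 0 then passages v (toTorus 1 z₀) else 0

/-- The `d`-symmetric differential `#^d_v 𝕋²` without its cone points: `d` named copies of the torus
`𝕋²`, each slit along the projection of the segment from `0` to `v`, glued cyclically along
opposite edges of the slits (with multiplicity where the projected segment overlaps or crosses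
itself). The points over the ends `[0]` and `[v]` of the slit are the cone points and are removed
(a single point over `[0] = [v]` for the degenerated differentials, `v ∈ ℤ²`).
The gluing is expressed by the topology below, the one-form by the projection `base` to `𝕋²`, which
is a local homeomorphism: the form is the pull-back of `dz`. -/
@[ext] structure Surface (d : ℕ) (v : Fin 2 → ℝ) where
  base : Torus 1
  sheet : ZMod d
  base_ne_start : base ≠ 0
  base_ne_end : base ≠ toTorus 1 v

/-- The topology of the glued surface: `U` is open if with each of its points it contains all
points that are reached from there by short steps in the plane, with the change of sheet given by
the gluing. -/
instance (d : ℕ) (v : Fin 2 → ℝ) : TopologicalSpace (Surface d v) where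
  IsOpen U := ∀ x ∈ U, ∀ z₀ : Fin 2 → ℝ, toTorus 1 z₀ = x.base →
    ∀ᶠ z in 𝓝 z₀, ∀ y : Surface d v,
      y.base = toTorus 1 z → y.sheet = x.sheet + (sheetJump v z₀ z : ZMod d) → y ∈ U
  isOpen_univ := fun x _ z₀ _ => Eventually.of_forall fun z y _ _ => mem_univ y
  isOpen_inter := fun U V hU hV x hx z₀ hz => by
    filter_upwards [hU x hx.1 z₀ hz, hV x hx.2 z₀ hz] with z h₁ h₂ y hb hs
    exact ⟨h₁ y hb hs, h₂ y hb hs⟩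
  isOpen_sUnion := fun S hS x hx z₀ hz => by
    obtain ⟨U, hUS, hxU⟩ := hx
    filter_upwards [hS U hUS x hxU z₀ hz] with z h y hb hs
    exact ⟨U, hUS, h y hb hs⟩

/-- The action of `ℤ/dℤ` on `#^d_v 𝕋²` by moving the sheets. -/
def deck {d : ℕ} {v : Fin 2 → ℝ} (a : ZMod d) (x : Surface d v) : Surface d v :=
  ⟨x.base, x.sheet + a, x.base_ne_start, x.base_ne_end⟩

/-- `C` is an open cylinder in direction `θ`: an open set which is the image of an isometric
embedding of some `ℝ/wℤ × (0,h)` that maps the loops `ℝ/wℤ × {t}` to closed geodesics in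
direction `θ`. In the flat coordinate of the torus the embedding is `(s, t) ↦ p + e^{iθ}(s + it)`. -/
def IsCylinder {d : ℕ} {v : Fin 2 → ℝ} (θ : ℝ) (C : Set (Surface d v)) : Prop :=
  ∃ w h : ℝ, 0 < w ∧ 0 < h ∧ ∃ Φ : AddCircle w × Ioo (0 : ℝ) h → Surface d v,
    IsOpenEmbedding Φ ∧ range Φ = C ∧
    ∃ p : Fin 2 → ℝ, ∀ (s : ℝ) (t : Ioo (0 : ℝ) h),
      (Φ ((s : AddCircle w), t)).base =
        toTorus 1 (p + s • ![Real.cos θ, Real.sin θ] + (t : ℝ) • ![-Real.sin θ, Real.cos θ])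

/-- The set of maximal cylinders of the direction foliation `𝓕_θ(#^d_v 𝕋²)`. -/
def cylinders (d : ℕ) (v : Fin 2 → ℝ) (θ : ℝ) : Set (Set (Surface d v)) :=
  {C | IsCylinder θ C ∧ ∀ C' : Set (Surface d v), IsCylinder θ C' → C ⊆ C' → C' = C}

/-- The direction `θ` is periodic: the surface is the union of the closures of its maximal
cylinders in direction `θ`. -/
def IsPeriodicDirection (d : ℕ) (v : Fin 2 → ℝ) (θ : ℝ) : Prop :=
  ∀ x : Surface d v, ∃ C ∈ cylinders d v θ, x ∈ closure C

/-- A simple direction: it is periodic, and every cylinder in this direction lies in the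
`ℤ/dℤ`-orbit of every other one. -/
def IsSimpleDirection (d : ℕ) (v : Fin 2 → ℝ) (θ : ℝ) : Prop :=
  IsPeriodicDirection d v θ ∧
    ∀ C ∈ cylinders d v θ, ∀ C' ∈ cylinders d v θ, ∃ a : ZMod d, C' = deck a '' C

/-- The open horizontal cylinder `𝓒_i` of the modular fiber `𝕋²_d`, `i ∈ ℤ/dℤ`, consists of the
points with vertical twist strictly between `i` and `i + 1`; this is its top boundary, where the
vertical twist is `i + 1`. It is also the bottom boundary of `𝓒_{i+1}`. -/
def topBoundary (d : ℕ) (i : ZMod d) : Set (Torus d) :=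
  {x | ∃ (z : Fin 2 → ℝ) (a : ℤ), toTorus d z = x ∧ (a : ZMod d) = i ∧ z 1 = (a : ℝ) + 1}

/-- The set `𝕋²_d(n)` of torsion points of order `n`. -/
def torsionOfOrder (d n : ℕ) : Set (Torus d) :=
  {x | 0 < n ∧ addOrderOf x = n}

/-- The linear action of `SL₂(ℤ)` on the plane. -/
def sl2act (A : Matrix.SpecialLinearGroup (Fin 2) ℤ) (z : Fin 2 → ℝ) : Fin 2 → ℝ :=
  ((A : Matrix (Fin 2) (Fin 2) ℤ).map (fun a : ℤ => (a : ℝ))).mulVec z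

end DSym

/-! ### Coordinates given by an integer matrix -/

namespace DSym

/-! A cylinder closes up in the torus, so its direction is that of a primitive integer vector, and
some `A ∈ SL₂(ℤ)` sends this vector to `(1, 0)` (`IsCylinder.exists_sl2`). The second coordinate
after `A`, the height, is constant along leaves; leaves inside a cylinder avoid the heights of both
cone points modulo 1.

If the height `b` of `v` is an integer, both cone points lie at height 0 modulo 1. The part of the
surface over the open strip of heights in `(0, 1)` is then a cyclic covering of an annulus, and its
monodromy is `b`: a unit step along the leaf has signed crossing number `b` with the slits. Its
components are the maximal cylinders. They correspond to the cosets of `⟨b⟩` in `ℤ/d`, so there are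
`gcd(b, d)` of them, and the deck group permutes them transitively (`encard_cylinders`,
`isSimpleDirection_of_height_eq`).

If that height is not an integer, the two cone heights cut the circle of heights into two arcs. Deck
transformations preserve height, so in a simple direction all cylinders lie over one arc and their
closures miss the other (`IsSimpleDirection.exists_height_eq`).

For torsion points, `n • [v] = 0` forces `n * b ≡ 0` modulo `d`. The converse is the construction of
a primitive row that gives `v` a prescribed height (`exists_height_of_addOrderOf`). -/

theorem toTorus_eq_iff {d : ℕ} {z z' : Fin 2 → ℝ} :
    toTorus d z = toTorus d z' ↔ ∃ a : Fin 2 → ℤ, ∀ i, z' i = z i + d * a i := by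
  rw [toTorus, toTorus, QuotientAddGroup.eq]
  constructor
  · rintro ⟨a, ha⟩
    exact ⟨a, fun i => by have := ha i; simp only [Pi.add_apply, Pi.neg_apply] at this; linarith⟩
  · rintro ⟨a, ha⟩
    exact ⟨a, fun i => by simp [ha i]⟩

theorem continuous_toTorus (d : ℕ) : Continuous (toTorus d) := continuous_quotient_mk'

variable (A : Matrix.SpecialLinearGroup (Fin 2) ℤ)

theorem sl2act_zero (z : Fin 2 → ℝ) : sl2act A z 0 = A 0 0 * z 0 + A 0 1 * z 1 := by
  simp [sl2act, Matrix.mulVec, dotProduct, Fin.sum_univ_two]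

theorem sl2act_one (z : Fin 2 → ℝ) : sl2act A z 1 = A 1 0 * z 0 + A 1 1 * z 1 := by
  simp [sl2act, Matrix.mulVec, dotProduct, Fin.sum_univ_two]

theorem entries_det : A 0 0 * A 1 1 - A 0 1 * A 1 0 = 1 := by
  have := A.det_coe
  rwa [Matrix.det_fin_two] at this

theorem entries_det_real : (A 0 0 * A 1 1 - A 0 1 * A 1 0 : ℝ) = 1 := by
  exact_mod_cast entries_det A

theorem sl2act_add (z z' : Fin 2 → ℝ) : sl2act A (z + z') = sl2act A z + sl2act A z' :=
  Matrix.mulVec_add ..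

theorem sl2act_sub (z z' : Fin 2 → ℝ) : sl2act A (z - z') = sl2act A z - sl2act A z' :=
  Matrix.mulVec_sub ..

theorem sl2act_smul (c : ℝ) (z : Fin 2 → ℝ) : sl2act A (c • z) = c • sl2act A z :=
  Matrix.mulVec_smul ..

theorem continuous_sl2act : Continuous (sl2act A) :=
  Continuous.matrix_mulVec continuous_const continuous_id

theorem continuous_sl2act_apply (i : Fin 2) : Continuous fun z => sl2act A z i :=
  (continuous_apply i).comp (continuous_sl2act A)

theorem det2_eq (v w : Fin 2 → ℝ) :
    det2 v w = sl2act A v 0 * sl2act A w 1 - sl2act A v 1 * sl2act A w 0 := by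
  have := entries_det_real A
  simp only [det2, sl2act_zero, sl2act_one]
  linear_combination (- (v 0 * w 1 - v 1 * w 0)) * this

/-- The point whose image under `A` has coordinates `x` and `y`. -/
def ofCoords (x y : ℝ) : Fin 2 → ℝ := ![A 1 1 * x - A 0 1 * y, - A 1 0 * x + A 0 0 * y]

@[simp] theorem sl2act_ofCoords_zero (x y : ℝ) : sl2act A (ofCoords A x y) 0 = x := by
  simp only [sl2act_zero, ofCoords, Matrix.cons_val_zero, Matrix.cons_val_one]
  linear_combination x * entries_det_real A

@[simp] theorem sl2act_ofCoords_one (x y : ℝ) : sl2act A (ofCoords A x y) 1 = y := by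
  simp only [sl2act_one, ofCoords, Matrix.cons_val_zero, Matrix.cons_val_one]
  linear_combination y * entries_det_real A

theorem ext_sl2act {z z' : Fin 2 → ℝ} (h0 : sl2act A z 0 = sl2act A z' 0)
    (h1 : sl2act A z 1 = sl2act A z' 1) : z = z' := by
  have := entries_det_real A
  simp only [sl2act_zero, sl2act_one] at h0 h1
  ext i
  fin_cases i
  · simp only [Fin.zero_eta]
    linear_combination (z' 0 - z 0) * this + A 1 1 * h0 - A 0 1 * h1
  · simp only [Fin.mk_one]
    linear_combination (z' 1 - z 1) * this - A 1 0 * h0 + A 0 0 * h1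

theorem toTorus_one_eq_iff {z z' : Fin 2 → ℝ} : toTorus 1 z = toTorus 1 z' ↔
    ∃ i j : ℤ, sl2act A z' 0 = sl2act A z 0 + i ∧ sl2act A z' 1 = sl2act A z 1 + j := by
  rw [toTorus_eq_iff]
  have hA := entries_det_real A
  constructor
  · rintro ⟨a, ha⟩
    refine ⟨A 0 0 * a 0 + A 0 1 * a 1, A 1 0 * a 0 + A 1 1 * a 1, ?_, ?_⟩ <;>
    · simp only [sl2act_zero, sl2act_one, ha]
      push_cast
      ring
  · rintro ⟨i, j, hi, hj⟩
    have h : z' = z + ofCoords A i j := by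
      apply ext_sl2act A <;> simp [sl2act_add, hi, hj]
    refine ⟨![A 1 1 * i - A 0 1 * j, - A 1 0 * i + A 0 0 * j], fun k => ?_⟩
    rw [h]
    fin_cases k <;> simp [ofCoords]

theorem toTorus_one_eq_zero_iff {z : Fin 2 → ℝ} : toTorus 1 z = 0 ↔
    ∃ i j : ℤ, sl2act A z 0 = i ∧ sl2act A z 1 = j := by
  have h : (0 : Torus 1) = toTorus 1 0 := rfl
  rw [eq_comm, h, toTorus_one_eq_iff A]
  simp [sl2act]

/-! ### Counting slit crossings inside a strip -/

/-- The heights `n`, relative to a slit with height difference `b`, of the lattice points from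
which a slit runs across the strip of height one. -/
noncomputable def slitHeights (b : ℤ) : Finset ℤ := Finset.Ioc (-b) 0 ∪ Finset.Ioc 0 (-b)

theorem mem_slitHeights {b n : ℤ} : n ∈ slitHeights b ↔ (-b < n ∧ n ≤ 0) ∨ (0 < n ∧ n ≤ -b) := by
  simp [slitHeights]

theorem card_slitHeights (b : ℤ) : ((slitHeights b).card : ℤ) = |b| := by
  rcases le_total 0 b with h | h
  · simp [slitHeights, h, abs_of_nonneg h]
  · simp [slitHeights, h, abs_of_nonpos h]

theorem ne_zero_of_mem_slitHeights {b n : ℤ} (h : n ∈ slitHeights b) : b ≠ 0 := by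
  rw [mem_slitHeights] at h; omega

/-- The affine function which is integral along the slits that start at height `n`. -/
noncomputable def slitPosition (v : Fin 2 → ℝ) (b n : ℤ) (z : Fin 2 → ℝ) : ℝ :=
  (b * sl2act A z 0 - sl2act A v 0 * (sl2act A z 1 - n)) / |(b : ℝ)|

/-- The sheet reached from a base leaf after crossing all slits up to the point `z`. -/
noncomputable def sheetOf (v : Fin 2 → ℝ) (b : ℤ) (z : Fin 2 → ℝ) : ℤ :=
  ∑ n ∈ slitHeights b, ⌈slitPosition A v b n z⌉

variable {A} {v : Fin 2 → ℝ} {b : ℤ}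

theorem slitPosition_eq_add (hb : sl2act A v 1 = b) (n : ℤ) (z₀ z : Fin 2 → ℝ) :
    slitPosition A v b n z = slitPosition A v b n z₀ - det2 v (z - z₀) / |(b : ℝ)| := by
  rw [slitPosition, slitPosition, det2_eq A, sl2act_sub, hb, ← sub_div]
  simp only [Pi.sub_apply]
  ring

theorem continuous_slitPosition (n : ℤ) : Continuous (slitPosition A v b n) := by
  unfold slitPosition
  have := continuous_sl2act_apply A 0
  have := continuous_sl2act_apply A 1
  fun_prop

open Classical in
-- By `slitPosition_eq_add` the position increases towards the right of `v`. The ceiling is constant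
-- just to the left of an integer and jumps by one just to its right, which matches the convention
-- that slit points belong to the left edge.
theorem eventually_ceil_slitPosition (hb : sl2act A v 1 = b) {n : ℤ} (hn : n ∈ slitHeights b)
    (z₀ : Fin 2 → ℝ) : ∀ᶠ z in 𝓝 z₀, ⌈slitPosition A v b n z⌉ = ⌈slitPosition A v b n z₀⌉ +
      if det2 v (z - z₀) < 0 ∧ ∃ k : ℤ, slitPosition A v b n z₀ = k then 1 else 0 := by
  have hb0 : 0 < |(b : ℝ)| := abs_pos.2 (Int.cast_ne_zero.2 (ne_zero_of_mem_slitHeights hn))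
  have hc := (continuous_slitPosition (A := A) (v := v) (b := b) n).continuousAt (x := z₀)
  by_cases hk : ∃ k : ℤ, slitPosition A v b n z₀ = k
  · obtain ⟨k, hk⟩ := hk
    have h1 := hc.eventually (Ioo_mem_nhds (a := (k : ℝ) - 1) (b := (k : ℝ) + 1)
      (by rw [hk]; linarith) (by rw [hk]; linarith))
    filter_upwards [h1] with z hz
    have he := slitPosition_eq_add hb n z₀ z
    simp only [hk, Int.ceil_intCast, Int.cast_inj, exists_eq', and_true]
    split_ifs with hd
    · have : det2 v (z - z₀) / |(b : ℝ)| < 0 := div_neg_of_neg_of_pos hd hb0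
      rw [Int.ceil_eq_iff]
      push_cast
      constructor
      · linarith
      · exact hz.2.le
    · have : 0 ≤ det2 v (z - z₀) / |(b : ℝ)| := div_nonneg (not_lt.1 hd) hb0.le
      rw [Int.ceil_eq_iff]
      push_cast
      constructor
      · linarith [hz.1]
      · linarith
  · have hlt : slitPosition A v b n z₀ < ⌈slitPosition A v b n z₀⌉ :=
      lt_of_le_of_ne (Int.le_ceil _) fun h => hk ⟨_, h⟩
    have hgt : (⌈slitPosition A v b n z₀⌉ : ℝ) - 1 < slitPosition A v b n z₀ := by
      linarith [Int.ceil_lt_add_one (slitPosition A v b n z₀)]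
    filter_upwards [hc.eventually (Ioo_mem_nhds hgt hlt)] with z hz
    simp only [hk, and_false, if_false, add_zero]
    rw [Int.ceil_eq_iff]
    exact ⟨hz.1, hz.2.le⟩

open Classical in
-- A passage through `[z]` at parameter `s` is a lattice translate of the segment through `z`. Its
-- starting height `n` determines `s = (height - n) / b`; the condition `0 < s < 1` becomes `n ∈
-- slitHeights b`, and integrality of the starting abscissa becomes integrality of the slit
-- position. For `b = 0` both counts vanish.
theorem passages_eq_card (hb : sl2act A v 1 = b) {z : Fin 2 → ℝ}
    (hz : sl2act A z 1 ∈ Ioo (0 : ℝ) 1) : passages v (toTorus 1 z) =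
      ((slitHeights b).filter fun n => ∃ k : ℤ, slitPosition A v b n z = k).card := by
  rw [passages, ← Set.ncard_coe_finset]
  symm
  apply Set.ncard_congr fun (n : ℤ) _ => (sl2act A z 1 - n) / (b : ℝ)
  · intro n hn
    simp only [Finset.coe_filter, mem_ofPred_eq] at hn
    obtain ⟨hn, k, hk⟩ := hn
    have hb0 : (b : ℝ) ≠ 0 := Int.cast_ne_zero.2 (ne_zero_of_mem_slitHeights hn)
    refine ⟨?_, ?_⟩
    · rcases mem_slitHeights.1 hn with ⟨h1, h2⟩ | ⟨h1, h2⟩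
      · have hbp : (0 : ℝ) < b := by exact_mod_cast (by omega : 0 < b)
        have h1' : (-b : ℝ) + 1 ≤ n := by exact_mod_cast h1
        have h2' : (n : ℝ) ≤ 0 := by exact_mod_cast h2
        exact ⟨div_pos (by linarith [hz.1]) hbp, (div_lt_one hbp).2 (by linarith [hz.2])⟩
      · have hbp : (b : ℝ) < 0 := by exact_mod_cast (by omega : b < 0)
        have h1' : (1 : ℝ) ≤ n := by exact_mod_cast h1
        have h2' : (n : ℝ) ≤ -b := by exact_mod_cast h2
        exact ⟨div_pos_of_neg_of_neg (by linarith [hz.2]) hbp,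
          (div_lt_one_of_neg hbp).2 (by linarith [hz.1])⟩
    · rw [toTorus_one_eq_iff A]
      rw [slitPosition, div_eq_iff (abs_ne_zero.2 hb0)] at hk
      refine ⟨k * b.sign, n, ?_, ?_⟩
      · have hs : (b.sign : ℝ) * b = |(b : ℝ)| := by exact_mod_cast Int.sign_mul_self_eq_abs b
        simp only [sl2act_smul, Pi.smul_apply, smul_eq_mul]
        push_cast
        rw [← hs] at hk
        field_simp
        linear_combination hk
      · simp only [sl2act_smul, Pi.smul_apply, smul_eq_mul, hb]
        field_simp
        ring
  · intro n n' hn hn' h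
    simp only [Finset.coe_filter, mem_ofPred_eq] at hn
    have hb0 : (b : ℝ) ≠ 0 := Int.cast_ne_zero.2 (ne_zero_of_mem_slitHeights hn.1)
    field_simp at h
    exact_mod_cast (by linarith : (n : ℝ) = n')
  · rintro s ⟨hs, h⟩
    rw [toTorus_one_eq_iff A] at h
    obtain ⟨i, n, hi, hn⟩ := h
    simp only [sl2act_smul, Pi.smul_apply, smul_eq_mul, hb] at hi hn
    have hb0 : (b : ℝ) ≠ 0 := by
      intro h0
      rw [hn, h0] at hz
      have h1 : (0 : ℝ) < n := by simpa using hz.1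
      have h2 : (n : ℝ) < 1 := by simpa using hz.2
      norm_cast at h1 h2
      omega
    refine ⟨n, ?_, ?_⟩
    · simp only [Finset.coe_filter, mem_ofPred_eq, mem_slitHeights]
      refine ⟨?_, i * b.sign, ?_⟩
      · rcases lt_or_gt_of_ne hb0 with h | h
        · right
          have h1 : s * b < 0 := mul_neg_of_pos_of_neg hs.1 h
          have h2 : (b : ℝ) < s * b := by nlinarith [hs.2]
          have h3 : (0 : ℝ) < n := by linarith [hz.1]
          have h4 : (n : ℝ) < -b + 1 := by linarith [hz.2]
          norm_cast at h3 h4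
          omega
        · left
          have h1 : 0 < s * b := mul_pos hs.1 h
          have h2 : s * b < b := by nlinarith [hs.2]
          have h3 : (n : ℝ) < 1 := by linarith [hz.2]
          have h4 : (-b : ℝ) < n := by linarith [hz.1]
          norm_cast at h3 h4
          omega
      · have hs : (b.sign : ℝ) * |(b : ℝ)| = b := by exact_mod_cast Int.sign_mul_abs b
        rw [slitPosition, div_eq_iff (abs_ne_zero.2 hb0), hi, hn]
        push_cast
        rw [mul_assoc, hs]
        ring
    · rw [hn]
      field_simp
      ring

/-- Inside the strip the sheet change has a potential: this is what trivializes the gluing there. -/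
theorem eventually_sheetOf (hb : sl2act A v 1 = b) {z₀ : Fin 2 → ℝ}
    (hz : sl2act A z₀ 1 ∈ Ioo (0 : ℝ) 1) :
    ∀ᶠ z in 𝓝 z₀, sheetOf A v b z = sheetOf A v b z₀ + (sheetJump v z₀ z : ℤ) := by
  classical
  have h := (Finset.eventually_all (slitHeights b)).2 fun n hn =>
    eventually_ceil_slitPosition hb hn z₀
  filter_upwards [h] with z hz'
  rw [sheetOf, Finset.sum_congr rfl hz', Finset.sum_add_distrib, ← sheetOf, sheetJump,
    passages_eq_card hb hz]
  congr 1
  by_cases hd : det2 v (z - z₀) < 0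
  · simp [hd]
  · simp [hd]

/-- The monodromy: a unit translation along the leaf crosses each of the `|b|` families of slits
once, always with the sign of `b`. -/
theorem sheetOf_add {z z' : Fin 2 → ℝ} {i : ℤ}
    (h0 : sl2act A z' 0 = sl2act A z 0 + i) (h1 : sl2act A z' 1 = sl2act A z 1) :
    sheetOf A v b z' = sheetOf A v b z + i * b := by
  have h : ∀ n ∈ slitHeights b,
      ⌈slitPosition A v b n z'⌉ = ⌈slitPosition A v b n z⌉ + b.sign * i := by
    intro n hn
    have hb0 : (b : ℝ) ≠ 0 := Int.cast_ne_zero.2 (ne_zero_of_mem_slitHeights hn)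
    have hs : (b.sign : ℝ) * |(b : ℝ)| = b := by exact_mod_cast Int.sign_mul_abs b
    rw [← Int.ceil_add_intCast, slitPosition, slitPosition, h0, h1,
      div_add' _ _ _ (abs_ne_zero.2 hb0)]
    push_cast
    congr 2
    linear_combination (-(i : ℝ)) * hs
  rw [sheetOf, Finset.sum_congr rfl h, Finset.sum_add_distrib, ← sheetOf, Finset.sum_const,
    nsmul_eq_mul]
  congr 1
  have := card_slitHeights b
  rw [this]
  linear_combination i * (Int.sign_mul_abs b)

theorem sheetJump_congr {z₀ z z₀' z' : Fin 2 → ℝ} (h : toTorus 1 z₀ = toTorus 1 z₀')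
    (h' : z - z₀ = z' - z₀') : sheetJump v z₀ z = sheetJump v z₀' z' := by
  rw [sheetJump, sheetJump, h, h']

end DSym

/-! ### Lifting strips to the surface -/

namespace DSym

variable (A : Matrix.SpecialLinearGroup (Fin 2) ℤ) {d : ℕ} {v : Fin 2 → ℝ} {b : ℤ}

/-- The strip of height one in the plane which is mapped by `A` to the horizontal strip
between the heights `0` and `1`. -/
abbrev Strip : Type := {z : Fin 2 → ℝ // sl2act A z 1 ∈ Ioo (0 : ℝ) 1}

variable {A}

theorem ne_intCast_of_mem_Ioo {x : ℝ} (hx : x ∈ Ioo (0 : ℝ) 1) (k : ℤ) : x ≠ k := by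
  rintro rfl
  obtain ⟨h1, h2⟩ := hx
  norm_cast at h1 h2
  omega

/-- The point over `[z]` on the sheet which is reached from the sheet `j` along the strip. -/
noncomputable def sheetMap (hb : sl2act A v 1 = b) (j : ZMod d) (z : Strip A) : Surface d v where
  base := toTorus 1 z
  sheet := j + (sheetOf A v b z : ZMod d)
  base_ne_start h := by
    obtain ⟨_, k, _, hk⟩ := (toTorus_one_eq_zero_iff A).1 h
    exact ne_intCast_of_mem_Ioo z.2 k hk
  base_ne_end h := by
    obtain ⟨_, k, _, hk⟩ := (toTorus_one_eq_iff A).1 h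
    refine ne_intCast_of_mem_Ioo z.2 (b - k) ?_
    push_cast
    linarith

theorem isOpen_surface_iff {U : Set (Surface d v)} : IsOpen U ↔
    ∀ x ∈ U, ∀ z₀ : Fin 2 → ℝ, toTorus 1 z₀ = x.base →
      ∀ᶠ z in 𝓝 z₀, ∀ y : Surface d v,
        y.base = toTorus 1 z → y.sheet = x.sheet + (sheetJump v z₀ z : ZMod d) → y ∈ U :=
  Iff.rfl

theorem continuous_base : Continuous (Surface.base : Surface d v → Torus 1) := by
  rw [continuous_def]
  intro V hV
  rw [isOpen_surface_iff]
  intro x hx z₀ hz₀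
  have h : ∀ᶠ z in 𝓝 z₀, toTorus 1 z ∈ V :=
    (continuous_toTorus 1).continuousAt.eventually (hV.mem_nhds (by rw [hz₀]; exact hx))
  filter_upwards [h] with z hz y hy _
  rw [mem_preimage, hy]
  exact hz

theorem continuous_sheetMap (hb : sl2act A v 1 = b) (j : ZMod d) :
    Continuous (sheetMap hb j) := by
  rw [continuous_def]
  intro U hU
  rw [isOpen_iff_mem_nhds]
  intro z₀ hz₀
  have h1 := isOpen_surface_iff.1 hU _ hz₀ z₀ rfl
  have h2 := eventually_sheetOf hb z₀.2
  have h3 : ∀ᶠ z : Fin 2 → ℝ in 𝓝 ↑z₀, ∀ hz, sheetMap hb j ⟨z, hz⟩ ∈ U := by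
    filter_upwards [h1, h2] with z hz1 hz2 hz
    refine hz1 _ rfl ?_
    simp only [sheetMap, hz2]
    push_cast
    ring
  have h4 : ∀ᶠ z : Strip A in 𝓝 z₀, ∀ hz, sheetMap hb j ⟨z, hz⟩ ∈ U :=
    continuous_subtype_val.continuousAt.eventually h3
  filter_upwards [h4] with z hz
  exact hz z.2

/-- The topology tests every representative `z₀` of the base point; a lattice translation moves it
to the representative `z₁` in the strip, and sheet jumps are invariant under this. -/
theorem isOpenMap_sheetMap (hb : sl2act A v 1 = b) (j : ZMod d) :
    IsOpenMap (sheetMap hb j) := by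
  intro V hV
  rw [isOpen_surface_iff]
  rintro x ⟨z₁, hz₁, rfl⟩ z₀ hz₀
  have hS : IsOpen {z : Fin 2 → ℝ | sl2act A z 1 ∈ Ioo (0 : ℝ) 1} :=
    isOpen_Ioo.preimage (continuous_sl2act_apply A 1)
  have h1 : ∀ᶠ z : Fin 2 → ℝ in 𝓝 ↑z₁, z ∈ (↑) '' V :=
    (hS.isOpenMap_subtype_val V hV).mem_nhds ⟨z₁, hz₁, rfl⟩
  have h2 := eventually_sheetOf hb z₁.2
  have hc : Tendsto (fun z => z - z₀ + (z₁ : Fin 2 → ℝ)) (𝓝 z₀) (𝓝 ↑z₁) := by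
    have : Continuous fun z => z - z₀ + (z₁ : Fin 2 → ℝ) := by fun_prop
    simpa using this.tendsto z₀
  filter_upwards [hc.eventually h1, hc.eventually h2] with z hz1 hz2 y hyb hys
  obtain ⟨z', hz', he⟩ := hz1
  refine ⟨z', hz', ?_⟩
  ext
  · rw [hyb]
    have h0 : (QuotientAddGroup.mk z₀ : Torus 1) = QuotientAddGroup.mk (z₁ : Fin 2 → ℝ) := hz₀
    simp only [sheetMap, he, toTorus, QuotientAddGroup.mk_add, QuotientAddGroup.mk_sub, h0]
    abel
  · rw [hys]
    have h0 : toTorus 1 (z₁ : Fin 2 → ℝ) = toTorus 1 z₀ := hz₀.symm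
    have hj : sheetJump v z₁ (z - z₀ + z₁) = sheetJump v z₀ z := sheetJump_congr h0 (by abel)
    simp only [sheetMap, he, hz2, hj]
    push_cast
    ring

theorem sheetMap_eq_iff (hb : sl2act A v 1 = b) {j j' : ZMod d} {z z' : Strip A} :
    sheetMap hb j z = sheetMap hb j' z' ↔ ∃ i : ℤ, sl2act A z' 0 = sl2act A z 0 + i ∧
      sl2act A z' 1 = sl2act A z 1 ∧ j = j' + i * b := by
  rw [Surface.ext_iff]
  simp only [sheetMap, toTorus_one_eq_iff A]
  constructor
  · rintro ⟨⟨i, k, hi, hk⟩, hs⟩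
    have hk0 : k = 0 := by
      have h1 := z.2
      have h2 := z'.2
      simp only [mem_Ioo] at h1 h2
      have h3 : (-1 : ℝ) < k := by linarith [h1.2, h2.1]
      have h4 : (k : ℝ) < 1 := by linarith [h1.1, h2.2]
      norm_cast at h3 h4
      omega
    subst hk0
    rw [Int.cast_zero, add_zero] at hk
    refine ⟨i, hi, hk, ?_⟩
    rw [sheetOf_add hi hk] at hs
    push_cast at hs
    linear_combination hs
  · rintro ⟨i, hi, hk, hs⟩
    refine ⟨⟨i, 0, hi, by simpa using hk⟩, ?_⟩
    rw [sheetOf_add hi hk, hs]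
    push_cast
    ring

theorem range_sheetMap_subset (hb : sl2act A v 1 = b) {j j' : ZMod d} {i : ℤ}
    (h : j = j' + i * b) : range (sheetMap hb j) ⊆ range (sheetMap hb j') := by
  rintro _ ⟨z, rfl⟩
  refine ⟨⟨z + ofCoords A i 0, by simpa [sl2act_add] using z.2⟩, Eq.symm ?_⟩
  rw [sheetMap_eq_iff]
  exact ⟨i, by simp [sl2act_add], by simp [sl2act_add], h⟩

theorem range_sheetMap_eq (hb : sl2act A v 1 = b) {j j' : ZMod d} {i : ℤ}
    (h : j = j' + i * b) : range (sheetMap hb j) = range (sheetMap hb j') :=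
  (range_sheetMap_subset hb h).antisymm
    (range_sheetMap_subset hb (i := -i) (by rw [h]; push_cast; ring))

theorem nonempty_strip : Nonempty (Strip A) :=
  ⟨⟨ofCoords A 0 (1 / 2), by rw [sl2act_ofCoords_one]; norm_num⟩⟩

theorem range_sheetMap_eq_or_disjoint (hb : sl2act A v 1 = b) (j j' : ZMod d) :
    range (sheetMap hb j) = range (sheetMap hb j') ∨
      Disjoint (range (sheetMap hb j)) (range (sheetMap hb j')) := by
  by_cases h : Disjoint (range (sheetMap hb j)) (range (sheetMap hb j'))
  · exact Or.inr h
  · obtain ⟨_, ⟨z, rfl⟩, ⟨z', hz⟩⟩ := Set.not_disjoint_iff.1 h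
    obtain ⟨i, _, _, hi⟩ := (sheetMap_eq_iff hb).1 hz.symm
    exact Or.inl (range_sheetMap_eq hb hi)

/-- Going around the annulus shifts the sheet by `b`, so lifted strips are indexed by cosets of
`⟨b⟩`. -/
theorem range_sheetMap_eq_iff (hb : sl2act A v 1 = b) {j j' : ZMod d} :
    range (sheetMap hb j) = range (sheetMap hb j') ↔
      -j + j' ∈ AddSubgroup.zmultiples (b : ZMod d) := by
  constructor
  · intro h
    obtain ⟨z⟩ := nonempty_strip (A := A)
    have hz : sheetMap hb j z ∈ range (sheetMap hb j') := h ▸ mem_range_self z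
    obtain ⟨z', hz'⟩ := hz
    obtain ⟨i, _, _, hi⟩ := (sheetMap_eq_iff hb).1 hz'
    exact ⟨i, by simp [hi]⟩
  · rintro ⟨i, hi⟩
    simp only [zsmul_eq_mul] at hi
    exact (range_sheetMap_eq hb (i := i) (by rw [hi]; ring)).symm

theorem mem_range_sheetMap (hb : sl2act A v 1 = b) (x : Surface d v) {z : Fin 2 → ℝ}
    (hz : sl2act A z 1 ∈ Ioo (0 : ℝ) 1) (hx : x.base = toTorus 1 z) :
    x ∈ range (sheetMap hb (x.sheet - (sheetOf A v b z : ZMod d))) :=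
  ⟨⟨z, hz⟩, by ext <;> simp [sheetMap, hx]⟩

theorem deck_image_range_sheetMap (hb : sl2act A v 1 = b) (a j : ZMod d) :
    deck a '' range (sheetMap hb j) = range (sheetMap hb (j + a)) := by
  rw [← range_comp]
  congr 1
  funext z
  ext
  · rfl
  · simp only [Function.comp, deck, sheetMap]
    ring

/-- Lifted strips are open and pairwise equal or disjoint, so a connected set covered by them stays
in one. -/
theorem subset_range_sheetMap_of_isPreconnected (hb : sl2act A v 1 = b) {C : Set (Surface d v)}
    (hC : IsPreconnected C) (hC' : C.Nonempty)
    (h : ∀ x ∈ C, ∃ z, sl2act A z 1 ∈ Ioo (0 : ℝ) 1 ∧ x.base = toTorus 1 z) :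
    ∃ j : ZMod d, C ⊆ range (sheetMap hb j) := by
  obtain ⟨x, hx⟩ := hC'
  obtain ⟨z, hz, hxz⟩ := h x hx
  refine ⟨_, hC.subset_left_of_subset_union (u := range (sheetMap hb
    (x.sheet - (sheetOf A v b z : ZMod d))))
    (v := ⋃ j ∈ {j : ZMod d | Disjoint (range (sheetMap hb
      (x.sheet - (sheetOf A v b z : ZMod d)))) (range (sheetMap hb j))}, range (sheetMap hb j))
    (isOpenMap_sheetMap hb _).isOpen_range
    (isOpen_biUnion fun j _ => (isOpenMap_sheetMap hb j).isOpen_range)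
    (Set.disjoint_iUnion₂_right.2 fun j hj => hj) ?_ ⟨x, hx, mem_range_sheetMap hb x hz hxz⟩⟩
  intro y hy
  obtain ⟨z', hz', hyz'⟩ := h y hy
  have hmem := mem_range_sheetMap hb y hz' hyz'
  rcases range_sheetMap_eq_or_disjoint hb (x.sheet - (sheetOf A v b z : ZMod d))
    (y.sheet - (sheetOf A v b z' : ZMod d)) with h | h
  · exact Or.inl (h ▸ hmem)
  · exact Or.inr (mem_biUnion h hmem)

/-! ### Heights along cylinders in a rational direction -/

/-- The point with coordinates `s` and `t` in the orthonormal frame at `p` whose first vector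
has direction `θ`. -/
noncomputable def framePoint (θ : ℝ) (p : Fin 2 → ℝ) (s t : ℝ) : Fin 2 → ℝ :=
  p + s • ![Real.cos θ, Real.sin θ] + t • ![-Real.sin θ, Real.cos θ]

theorem continuous_framePoint (θ : ℝ) (p : Fin 2 → ℝ) :
    Continuous fun x : ℝ × ℝ => framePoint θ p x.1 x.2 := by
  unfold framePoint
  fun_prop

variable {θ ℓ : ℝ}

/-- The hypotheses on the bottom row say that `ℓ (cos θ, sin θ)` is the integer vector which `A`
sends to `(1, 0)`. Heights therefore do not depend on `s`, and they grow with slope `ℓ` in `t`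
because `A` preserves area. -/
theorem sl2act_framePoint_one (hc : (A 1 1 : ℝ) = ℓ * Real.cos θ)
    (hs : (A 1 0 : ℝ) = -(ℓ * Real.sin θ)) (p : Fin 2 → ℝ) (s t : ℝ) :
    sl2act A (framePoint θ p s t) 1 = sl2act A p 1 + ℓ * t := by
  simp only [framePoint, sl2act_add, sl2act_smul, Pi.add_apply, Pi.smul_apply, smul_eq_mul,
    sl2act_one A ![_, _], Matrix.cons_val_zero, Matrix.cons_val_one, hc, hs]
  linear_combination (ℓ * t) * Real.sin_sq_add_cos_sq θ

theorem sl2act_framePoint_zero (hℓ : 0 < ℓ) (hc : (A 1 1 : ℝ) = ℓ * Real.cos θ)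
    (hs : (A 1 0 : ℝ) = -(ℓ * Real.sin θ)) (p : Fin 2 → ℝ) (s t : ℝ) :
    sl2act A (framePoint θ p s t) 0 =
      sl2act A p 0 + s / ℓ + t * sl2act A ![-Real.sin θ, Real.cos θ] 0 := by
  have h := entries_det_real A
  rw [hc, hs] at h
  simp only [framePoint, sl2act_add, sl2act_smul, Pi.add_apply, Pi.smul_apply, smul_eq_mul,
    sl2act_zero A ![Real.cos θ, _], Matrix.cons_val_zero, Matrix.cons_val_one]
  have : (A 0 0 : ℝ) * Real.cos θ + A 0 1 * Real.sin θ = 1 / ℓ := by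
    rw [eq_div_iff hℓ.ne']
    linear_combination h
  rw [this]
  ring

instance (w : ℝ) : PreconnectedSpace (AddCircle w) :=
  inferInstanceAs (PreconnectedSpace (Quotient _))

/-- In the direction of an integer vector, no closed geodesic of a cylinder has integral height. -/
theorem cylinder_height_ne (hℓ : 0 < ℓ) (hc : (A 1 1 : ℝ) = ℓ * Real.cos θ)
    (hs : (A 1 0 : ℝ) = -(ℓ * Real.sin θ)) {w h : ℝ}
    {Φ : AddCircle w × Ioo (0 : ℝ) h → Surface d v} {p : Fin 2 → ℝ}
    (hΦ : ∀ (s : ℝ) (t : Ioo (0 : ℝ) h),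
      (Φ ((s : AddCircle w), t)).base = toTorus 1 (framePoint θ p s t))
    {t : ℝ} (ht : t ∈ Ioo 0 h) (k : ℤ) :
    sl2act A p 1 + ℓ * t ≠ k ∧ sl2act A p 1 + ℓ * t ≠ sl2act A v 1 + k := by
  constructor
  · intro hk
    have h1 := hΦ (-ℓ * (sl2act A p 0 + t * sl2act A ![-Real.sin θ, Real.cos θ] 0)) ⟨t, ht⟩
    apply (Φ (_, ⟨t, ht⟩)).base_ne_start
    rw [h1, toTorus_one_eq_zero_iff A]
    refine ⟨0, k, ?_, ?_⟩
    · rw [sl2act_framePoint_zero hℓ hc hs]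
      field_simp
      simp
    · rw [sl2act_framePoint_one hc hs, hk]
  · intro hk
    have h1 := hΦ (ℓ * (sl2act A v 0 - sl2act A p 0 -
      t * sl2act A ![-Real.sin θ, Real.cos θ] 0)) ⟨t, ht⟩
    apply (Φ (_, ⟨t, ht⟩)).base_ne_end
    rw [h1, eq_comm, toTorus_one_eq_iff A]
    refine ⟨0, k, ?_, ?_⟩
    · rw [sl2act_framePoint_zero hℓ hc hs]
      field_simp
      push_cast
      ring
    · rw [sl2act_framePoint_one hc hs, hk]

/-- An interval that contains no integer lies between two consecutive ones. -/
theorem height_mem_Ioo_floor {α ℓ h : ℝ} (hℓ : 0 < ℓ)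
    (hne : ∀ t ∈ Ioo 0 h, ∀ k : ℤ, α + ℓ * t ≠ k) {t : ℝ} (ht : t ∈ Ioo 0 h) :
    α + ℓ * t - ⌊α⌋ ∈ Ioo (0 : ℝ) 1 := by
  have hpos := mul_pos hℓ ht.1
  refine ⟨by linarith [Int.floor_le α], ?_⟩
  by_contra hcon
  have hlt := Int.lt_floor_add_one α
  refine hne ((⌊α⌋ + 1 - α) / ℓ) ⟨div_pos (by linarith) hℓ, lt_of_le_of_lt ?_ ht.2⟩ (⌊α⌋ + 1) ?_
  · rw [div_le_iff₀ hℓ]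
    linarith
  · push_cast
    field_simp
    ring

theorem IsCylinder.subset_range_sheetMap (hb : sl2act A v 1 = b) (hℓ : 0 < ℓ)
    (hc : (A 1 1 : ℝ) = ℓ * Real.cos θ) (hs : (A 1 0 : ℝ) = -(ℓ * Real.sin θ))
    {C : Set (Surface d v)} (hC : IsCylinder θ C) :
    ∃ j : ZMod d, C ⊆ range (sheetMap hb j) := by
  obtain ⟨w, h, hw, hh, Φ, hΦo, rfl, p, hΦ⟩ := hC
  have : PreconnectedSpace (Ioo (0 : ℝ) h) := Subtype.preconnectedSpace isPreconnected_Ioo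
  have : Nonempty (Ioo (0 : ℝ) h) := ⟨⟨h / 2, by constructor <;> linarith⟩⟩
  apply subset_range_sheetMap_of_isPreconnected hb (isPreconnected_range hΦo.continuous)
    (range_nonempty Φ)
  rintro _ ⟨⟨s, t⟩, rfl⟩
  obtain ⟨s, rfl⟩ := QuotientAddGroup.mk_surjective s
  have hm := height_mem_Ioo_floor hℓ (fun t ht k => (cylinder_height_ne hℓ hc hs hΦ ht k).1) t.2
  refine ⟨framePoint θ p s t - ofCoords A 0 ⌊sl2act A p 1⌋, ?_, ?_⟩
  · rw [sl2act_sub, Pi.sub_apply, sl2act_framePoint_one hc hs, sl2act_ofCoords_one]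
    exact hm
  · refine Eq.trans (b := toTorus 1 (framePoint θ p s t)) (hΦ s t)
      ((toTorus_one_eq_iff A).2 ⟨0, -⌊sl2act A p 1⌋, ?_, ?_⟩)
    · simp [sl2act_sub]
    · simp [sl2act_sub, ← sub_eq_add_neg]

end DSym

/-! ### Integral height: maximal cylinders and simplicity -/

namespace DSym

variable {A : Matrix.SpecialLinearGroup (Fin 2) ℤ} {d : ℕ} {v : Fin 2 → ℝ} {b : ℤ} {θ ℓ : ℝ}

/-- A leaf closes after `q` turns of length `ℓ`, where `q` is the order of `b` in `ℤ/d`; the strip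
has Euclidean height `1 / ℓ`. -/
theorem isCylinder_range_sheetMap [NeZero d] (hb : sl2act A v 1 = b) (hℓ : 0 < ℓ)
    (hc : (A 1 1 : ℝ) = ℓ * Real.cos θ) (hs : (A 1 0 : ℝ) = -(ℓ * Real.sin θ)) (j : ZMod d) :
    IsCylinder θ (range (sheetMap hb j)) := by
  have hq : 0 < addOrderOf (b : ZMod d) := addOrderOf_pos _
  set q := addOrderOf (b : ZMod d) with hqdef
  set c := sl2act A ![-Real.sin θ, Real.cos θ] 0 with hcdef
  have hw : 0 < ℓ * q := by positivity
  have hmem : ∀ (s : ℝ) (t : Ioo (0 : ℝ) (1 / ℓ)),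
      sl2act A (framePoint θ 0 s t) 1 ∈ Ioo (0 : ℝ) 1 := by
    intro s t
    rw [sl2act_framePoint_one hc hs]
    have h1 := mul_pos hℓ t.2.1
    have h2 := (lt_div_iff₀' hℓ).1 t.2.2
    simp only [sl2act, Matrix.mulVec_zero, Pi.zero_apply, zero_add]
    exact ⟨h1, h2⟩
  let F : ℝ → Ioo (0 : ℝ) (1 / ℓ) → Strip A := fun s t => ⟨framePoint θ 0 s t, hmem s t⟩
  have hF0 : ∀ s t, sl2act A (F s t) 0 = s / ℓ + t * c := by
    intro s t
    rw [sl2act_framePoint_zero hℓ hc hs]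
    simp [sl2act, hcdef]
  have hF1 : ∀ s t, sl2act A (F s t) 1 = ℓ * t := by
    intro s t
    rw [sl2act_framePoint_one hc hs]
    simp [sl2act]
  have heq : ∀ s t s' t', sheetMap hb j (F s t) = sheetMap hb j (F s' t') ↔
      (s : AddCircle (ℓ * q)) = s' ∧ t = t' := by
    intro s t s' t'
    have hi : ∀ i : ℤ, j = j + i * b ↔ (q : ℤ) ∣ i := fun i => by
      rw [left_eq_add, ← zsmul_eq_mul, addOrderOf_dvd_iff_zsmul_eq_zero]
    have hs' : (s : AddCircle (ℓ * q)) = s' ↔ ∃ n : ℤ, n • (ℓ * q) = s' - s := by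
      rw [eq_comm, ← sub_eq_zero, ← AddCircle.coe_sub, AddCircle.coe_eq_zero_iff]
    rw [sheetMap_eq_iff, hs']
    simp only [hF0, hF1, hi, zsmul_eq_mul]
    constructor
    · rintro ⟨i, h0, h1, n, rfl⟩
      have ht : t = t' := Subtype.ext (mul_left_cancel₀ hℓ.ne' h1).symm
      subst ht
      refine ⟨⟨n, ?_⟩, rfl⟩
      field_simp at h0
      push_cast at h0
      linear_combination -h0
    · rintro ⟨⟨n, h0⟩, rfl⟩
      refine ⟨q * n, ?_, rfl, dvd_mul_right _ _⟩
      field_simp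
      push_cast
      linear_combination -h0
  have hper : ∀ t, Function.Periodic (fun s => sheetMap hb j (F s t)) (ℓ * q) := by
    intro t s
    exact (heq _ _ _ _).2 ⟨AddCircle.coe_add_period _ _, rfl⟩
  let Φ : AddCircle (ℓ * q) × Ioo (0 : ℝ) (1 / ℓ) → Surface d v := fun x => (hper x.2).lift x.1
  have hΦ : ∀ (s : ℝ) t, Φ (s, t) = sheetMap hb j (F s t) := fun s t => rfl
  have hFc : Continuous fun x : ℝ × Ioo (0 : ℝ) (1 / ℓ) => F x.1 x.2 := by
    refine Continuous.subtype_mk ?_ _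
    exact (continuous_framePoint θ 0).comp (continuous_fst.prodMk
      (continuous_subtype_val.comp continuous_snd))
  have hΦc : Continuous Φ := by
    have hqm : IsOpenQuotientMap (Prod.map ((↑) : ℝ → AddCircle (ℓ * q))
        (id : Ioo (0 : ℝ) (1 / ℓ) → _)) :=
      QuotientAddGroup.isOpenQuotientMap_mk.prodMap IsOpenQuotientMap.id
    rw [hqm.isQuotientMap.continuous_iff]
    exact (continuous_sheetMap hb j).comp hFc
  have hΦi : Function.Injective Φ := by
    rintro ⟨s, t⟩ ⟨s', t'⟩ h
    obtain ⟨s, rfl⟩ := QuotientAddGroup.mk_surjective s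
    obtain ⟨s', rfl⟩ := QuotientAddGroup.mk_surjective s'
    exact Prod.ext_iff.2 ((heq s t s' t').1 h)
  -- `κ` is the covering from the strip to the cylinder. As `Φ ∘ κ` is `sheetMap`, openness and the
  -- range of `Φ` are inherited from `sheetMap`.
  let κ : Strip A → AddCircle (ℓ * q) × Ioo (0 : ℝ) (1 / ℓ) := fun z =>
    (((ℓ * (sl2act A z 0 - sl2act A z 1 / ℓ * c) : ℝ) : AddCircle (ℓ * q)),
      ⟨sl2act A z 1 / ℓ, div_pos z.2.1 hℓ, div_lt_div_of_pos_right z.2.2 hℓ⟩)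
  have hκΦ : ∀ z, Φ (κ z) = sheetMap hb j z := by
    intro z
    rw [hΦ]
    congr 1
    apply Subtype.ext
    apply ext_sl2act A
    · rw [hF0]
      field_simp
      ring
    · rw [hF1]
      field_simp
  have hκc : Continuous κ := by
    have h0 := (continuous_sl2act_apply A 0).comp (continuous_subtype_val (p := fun z =>
      sl2act A z 1 ∈ Ioo (0 : ℝ) 1))
    have h1 := (continuous_sl2act_apply A 1).comp (continuous_subtype_val (p := fun z =>
      sl2act A z 1 ∈ Ioo (0 : ℝ) 1))
    refine Continuous.prodMk ((AddCircle.continuous_mk' _).comp ?_) (Continuous.subtype_mk ?_ _)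
    · exact continuous_const.mul (h0.sub ((h1.div_const _).mul continuous_const))
    · exact h1.div_const _
  have hκs : Function.Surjective κ := by
    rintro ⟨s, t⟩
    obtain ⟨s, rfl⟩ := QuotientAddGroup.mk_surjective s
    refine ⟨F s t, hΦi ?_⟩
    rw [hκΦ]
    rfl
  refine ⟨ℓ * q, 1 / ℓ, hw, by positivity, Φ,
    IsOpenEmbedding.of_continuous_injective_isOpenMap hΦc hΦi ?_, ?_, 0, fun s t => rfl⟩
  · intro V hV
    have : Φ '' V = sheetMap hb j '' (κ ⁻¹' V) := by
      rw [← image_preimage_eq V hκs, image_image, image_preimage_eq V hκs]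
      simp only [hκΦ]
    rw [this]
    exact isOpenMap_sheetMap hb j _ (hV.preimage hκc)
  · rw [← hκs.range_comp]
    congr 1
    funext z
    exact hκΦ z

theorem cylinders_eq [NeZero d] (hb : sl2act A v 1 = b) (hℓ : 0 < ℓ)
    (hc : (A 1 1 : ℝ) = ℓ * Real.cos θ) (hs : (A 1 0 : ℝ) = -(ℓ * Real.sin θ)) :
    cylinders d v θ = range fun j => range (sheetMap hb j) := by
  have hmax : ∀ j j' : ZMod d, range (sheetMap hb j) ⊆ range (sheetMap hb j') →
      range (sheetMap hb j) = range (sheetMap hb j') := by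
    intro j j' h
    refine (range_sheetMap_eq_or_disjoint hb j j').resolve_right fun hd => ?_
    obtain ⟨z⟩ := nonempty_strip (A := A)
    exact Set.disjoint_left.1 hd (mem_range_self z) (h (mem_range_self z))
  ext C
  constructor
  · rintro ⟨hC, hCmax⟩
    obtain ⟨j, hj⟩ := hC.subset_range_sheetMap hb hℓ hc hs
    exact ⟨j, hCmax _ (isCylinder_range_sheetMap hb hℓ hc hs j) hj⟩
  · rintro ⟨j, rfl⟩
    refine ⟨isCylinder_range_sheetMap hb hℓ hc hs j, fun C' hC' hsub => ?_⟩
    obtain ⟨j', hj'⟩ := hC'.subset_range_sheetMap hb hℓ hc hs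
    refine (hsub.antisymm ?_).symm
    simpa only [hmax j j' (hsub.trans hj')] using hj'

theorem encard_cylinders [NeZero d] (hb : sl2act A v 1 = b) (hℓ : 0 < ℓ)
    (hc : (A 1 1 : ℝ) = ℓ * Real.cos θ) (hs : (A 1 0 : ℝ) = -(ℓ * Real.sin θ)) :
    (cylinders d v θ).encard = (Nat.gcd (b : ZMod d).val d : ℕ) := by
  rw [cylinders_eq hb hℓ hc hs]
  let H := AddSubgroup.zmultiples (b : ZMod d)
  let f : ZMod d ⧸ H → Set (Surface d v) := fun x => Quotient.liftOn' x
    (fun j => range (sheetMap hb j)) fun j j' h => (range_sheetMap_eq_iff hb).2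
      (QuotientAddGroup.leftRel_apply.1 h)
  have hf : Function.Injective f := by
    intro x y h
    obtain ⟨j, rfl⟩ := QuotientAddGroup.mk_surjective x
    obtain ⟨j', rfl⟩ := QuotientAddGroup.mk_surjective y
    exact QuotientAddGroup.eq.2 ((range_sheetMap_eq_iff hb).1 h)
  have hr : (range fun j => range (sheetMap hb j)) = range f :=
    (QuotientAddGroup.mk_surjective (s := H)).range_comp f
  have hcard : Nat.card (ZMod d ⧸ H) * (d / d.gcd (b : ZMod d).val) = d := by
    have h1 := AddSubgroup.card_eq_card_quotient_mul_card_addSubgroup H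
    rw [Nat.card_zmod, Nat.card_zmultiples] at h1
    have h2 := ZMod.addOrderOf_coe (b : ZMod d).val (NeZero.ne d)
    rw [ZMod.natCast_zmod_val] at h2
    rw [← h2, ← h1]
  rw [hr, ← image_univ, hf.encard_image, encard_univ, ENat.card_eq_coe_natCard]
  have hd : 0 < d := NeZero.pos d
  have hdvd := Nat.gcd_dvd_left d (b : ZMod d).val
  have hpos : 0 < d / d.gcd (b : ZMod d).val :=
    Nat.div_pos (Nat.le_of_dvd hd hdvd) (Nat.gcd_pos_of_pos_left _ hd)
  rw [Nat.gcd_comm]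
  norm_cast
  exact Nat.eq_of_mul_eq_mul_right hpos (hcard.trans (Nat.mul_div_cancel' hdvd).symm)

theorem isSimpleDirection_of_height_eq [NeZero d] (hb : sl2act A v 1 = b) (hℓ : 0 < ℓ)
    (hc : (A 1 1 : ℝ) = ℓ * Real.cos θ) (hs : (A 1 0 : ℝ) = -(ℓ * Real.sin θ)) :
    IsSimpleDirection d v θ := by
  rw [IsSimpleDirection, IsPeriodicDirection, cylinders_eq hb hℓ hc hs]
  refine ⟨fun x => ?_, ?_⟩
  -- There are finitely many cylinders, so it suffices that their union is dense.
  · simp only [exists_range_iff]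
    rw [← mem_iUnion, ← closure_iUnion_of_finite, mem_closure_iff]
    intro U hU hxU
    obtain ⟨z₁, hz₁⟩ := QuotientAddGroup.mk_surjective x.base
    let z₀ := z₁ - ofCoords A 0 ⌊sl2act A z₁ 1⌋
    have hz₀ : toTorus 1 z₀ = x.base := by
      rw [← hz₁, eq_comm]
      exact (toTorus_one_eq_iff A).2 ⟨0, -⌊sl2act A z₁ 1⌋, by simp [z₀, sl2act_sub],
        by simp [z₀, sl2act_sub, ← sub_eq_add_neg]⟩
    have h0 : sl2act A z₀ 1 = Int.fract (sl2act A z₁ 1) := by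
      simp [z₀, sl2act_sub]
    -- The representative `z₀` has height in `[0, 1)`; a small push upwards puts it into the open
    -- strip even when its height is 0.
    have hlim : Tendsto (fun t : ℝ => z₀ + ofCoords A 0 t) (𝓝[>] 0) (𝓝 z₀) := by
      have hcont : Continuous fun t : ℝ => z₀ + ofCoords A 0 t := by
        refine continuous_const.add (continuous_pi fun i => ?_)
        fin_cases i <;> simp only [ofCoords, Fin.zero_eta, Fin.mk_one, Matrix.cons_val_zero,
          Matrix.cons_val_one] <;> fun_prop
      have hz : ofCoords A 0 0 = 0 := by ext i; fin_cases i <;> simp [ofCoords]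
      have := hcont.tendsto 0
      rw [hz, add_zero] at this
      exact this.mono_left nhdsWithin_le_nhds
    have hev := hlim.eventually (isOpen_surface_iff.1 hU x hxU z₀ hz₀)
    have hlt : ∀ᶠ t : ℝ in 𝓝[>] 0, t ∈ Ioo 0 (1 - sl2act A z₀ 1) :=
      Ioo_mem_nhdsGT (by rw [h0]; linarith [Int.fract_lt_one (sl2act A z₁ 1)])
    obtain ⟨t, hU', ht⟩ := (hev.and hlt).exists
    have hmem : sl2act A (z₀ + ofCoords A 0 t) 1 ∈ Ioo (0 : ℝ) 1 := by
      rw [sl2act_add, Pi.add_apply, sl2act_ofCoords_one]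
      exact ⟨by linarith [ht.1, h0, Int.fract_nonneg (sl2act A z₁ 1)], by linarith [ht.2]⟩
    let j : ZMod d := x.sheet + (sheetJump v z₀ (z₀ + ofCoords A 0 t) : ZMod d) -
      (sheetOf A v b (z₀ + ofCoords A 0 t) : ZMod d)
    refine ⟨sheetMap hb j ⟨_, hmem⟩, hU' _ rfl ?_, mem_iUnion.2 ⟨j, mem_range_self _⟩⟩
    simp [sheetMap, j]
  · rintro _ ⟨j, rfl⟩ _ ⟨j', rfl⟩
    refine ⟨j' - j, ?_⟩
    simp only
    rw [deck_image_range_sheetMap, add_sub_cancel]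

end DSym

/-! ### A simple direction forces integral height -/

namespace DSym

variable {A : Matrix.SpecialLinearGroup (Fin 2) ℤ} {d : ℕ} {v : Fin 2 → ℝ} {b : ℤ} {θ ℓ : ℝ}

/-- Periodicity is a statement about all points, so a point is needed to obtain a cylinder. At least
one of two distinct nonzero half-integral points differs from `[v]`. -/
instance : Nonempty (Surface d v) := by
  have h1 : toTorus 1 ![1 / 2, 0] ≠ 0 := by
    intro h
    obtain ⟨a, ha⟩ := toTorus_eq_iff.1 (show toTorus 1 ![1 / 2, 0] = toTorus 1 0 from h)
    have h0 := ha 0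
    simp only [Pi.zero_apply, Matrix.cons_val_zero, Nat.cast_one, one_mul] at h0
    have : ((2 * a 0 : ℤ) : ℝ) = (-1 : ℤ) := by push_cast; linarith
    norm_cast at this
    omega
  have h2 : toTorus 1 ![0, 1 / 2] ≠ 0 := by
    intro h
    obtain ⟨a, ha⟩ := toTorus_eq_iff.1 (show toTorus 1 ![0, 1 / 2] = toTorus 1 0 from h)
    have h0 := ha 1
    simp only [Pi.zero_apply, Matrix.cons_val_one, Matrix.cons_val_fin_one, Nat.cast_one,
      one_mul] at h0
    have : ((2 * a 1 : ℤ) : ℝ) = (-1 : ℤ) := by push_cast; linarith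
    norm_cast at this
    omega
  have h3 : toTorus 1 ![1 / 2, 0] ≠ toTorus 1 ![0, 1 / 2] := by
    intro h
    obtain ⟨a, ha⟩ := toTorus_eq_iff.1 h
    have h0 := ha 0
    simp only [Matrix.cons_val_zero, Nat.cast_one, one_mul] at h0
    have : ((2 * a 0 : ℤ) : ℝ) = (-1 : ℤ) := by push_cast; linarith
    norm_cast at this
    omega
  by_cases h : toTorus 1 ![1 / 2, 0] = toTorus 1 v
  · exact ⟨⟨_, 0, h2, fun h' => h3 (h.trans h'.symm)⟩⟩
  · exact ⟨⟨_, 0, h1, h⟩⟩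

theorem IsSimpleDirection.exists_isCylinder (h : IsSimpleDirection d v θ) :
    ∃ C ∈ cylinders d v θ, IsCylinder θ C := by
  obtain ⟨x⟩ : Nonempty (Surface d v) := inferInstance
  obtain ⟨C, hC, _⟩ := h.1 x
  exact ⟨C, hC, hC.1⟩

/-- The direction of a cylinder is the direction of a primitive integer vector. -/
theorem IsCylinder.exists_sl2 {C : Set (Surface d v)} (hC : IsCylinder θ C) :
    ∃ (A : Matrix.SpecialLinearGroup (Fin 2) ℤ) (ℓ : ℝ), 0 < ℓ ∧
      (A 1 1 : ℝ) = ℓ * Real.cos θ ∧ (A 1 0 : ℝ) = -(ℓ * Real.sin θ) := by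
  obtain ⟨w, h, hw, hh, Φ, -, -, p, hΦ⟩ := hC
  have h0 := hΦ 0 ⟨h / 2, by constructor <;> linarith⟩
  have h1 := hΦ w ⟨h / 2, by constructor <;> linarith⟩
  rw [AddCircle.coe_period, ← AddCircle.coe_zero, h0] at h1
  obtain ⟨a, ha⟩ := toTorus_eq_iff.1 h1
  have ha0 : w * Real.cos θ = a 0 := by
    have := ha 0
    simp only [Pi.add_apply, Pi.smul_apply, smul_eq_mul, Matrix.cons_val_zero,
      Nat.cast_one] at this
    linarith
  have ha1 : w * Real.sin θ = a 1 := by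
    have := ha 1
    simp only [Pi.add_apply, Pi.smul_apply, smul_eq_mul, Matrix.cons_val_one,
      Matrix.cons_val_fin_one, Nat.cast_one] at this
    linarith
  have hg : 0 < Int.gcd (a 0) (a 1) := by
    rw [Int.gcd_pos_iff]
    by_contra! hcon
    rw [hcon.1, Int.cast_zero] at ha0
    rw [hcon.2, Int.cast_zero] at ha1
    have hcos := (mul_eq_zero.1 ha0).resolve_left hw.ne'
    have hsin := (mul_eq_zero.1 ha1).resolve_left hw.ne'
    have := Real.sin_sq_add_cos_sq θ
    rw [hcos, hsin] at this
    norm_num at this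
  obtain ⟨e0, e1, he, h0', h1'⟩ := Int.exists_gcd_one hg
  -- The bottom row `(-e1, e0)` annihilates the primitive vector `(e0, e1)` of the direction.
  obtain ⟨A, hA0, hA1⟩ := (Int.isCoprime_iff_gcd_eq_one.2 he).symm.neg_left.exists_SL2_row 1
  have hg' : (0 : ℝ) < Int.gcd (a 0) (a 1) := by exact_mod_cast hg
  refine ⟨A, w / Int.gcd (a 0) (a 1), div_pos hw hg', ?_, ?_⟩
  · have : (a 0 : ℝ) = e0 * Int.gcd (a 0) (a 1) := by exact_mod_cast h0'
    rw [hA1, div_mul_eq_mul_div, ha0, eq_div_iff hg'.ne', ← this]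
  · have : (a 1 : ℝ) = e1 * Int.gcd (a 0) (a 1) := by exact_mod_cast h1'
    rw [hA0, div_mul_eq_mul_div, ha1, ← neg_div, eq_div_iff hg'.ne']
    push_cast
    linarith

theorem isClosed_heights_Icc (α β : ℝ) :
    IsClosed {x : Torus 1 | ∃ z, toTorus 1 z = x ∧ sl2act A z 1 ∈ Icc α β} := by
  have hq : IsQuotientMap (toTorus 1) := isQuotientMap_quotient_mk'
  rw [← hq.isClosed_preimage]
  have hK : IsClosed ((fun x : ℝ => (x : AddCircle (1 : ℝ))) '' Icc α β) :=
    (isCompact_Icc.image (AddCircle.continuous_mk' 1)).isClosed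
  convert hK.preimage ((AddCircle.continuous_mk' (1 : ℝ)).comp (continuous_sl2act_apply A 1))
    using 1
  ext z
  constructor
  · rintro ⟨z', h, hz'⟩
    obtain ⟨_, j, _, hj⟩ := (toTorus_one_eq_iff A).1 h
    refine ⟨_, hz', ?_⟩
    change ((sl2act A z' 1 : ℝ) : AddCircle (1 : ℝ)) = (sl2act A z 1 : ℝ)
    rw [eq_comm, ← sub_eq_zero, ← AddCircle.coe_sub, AddCircle.coe_eq_zero_iff]
    exact ⟨j, by simp [hj]⟩
  · rintro ⟨y, hy, h⟩
    change (y : AddCircle (1 : ℝ)) = (sl2act A z 1 : ℝ) at h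
    rw [eq_comm, ← sub_eq_zero, ← AddCircle.coe_sub, AddCircle.coe_eq_zero_iff] at h
    obtain ⟨j, hj⟩ := h
    simp only [zsmul_eq_mul, mul_one] at hj
    refine ⟨z + ofCoords A 0 (-j), (toTorus_one_eq_iff A).2 ⟨0, j, ?_, ?_⟩, ?_⟩
    · simp [sl2act_add]
    · simp [sl2act_add]
    · simp only [sl2act_add, Pi.add_apply, sl2act_ofCoords_one, hj]
      convert hy using 1
      ring

/-- Every cylinder is a deck translate of one cylinder, so closures only reach heights in `[α, α + ℓ
* δ]` modulo 1. This interval lies in the closure of a single arc between the cone heights; with a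
second arc present, its midpoint would be uncovered. -/
theorem IsSimpleDirection.exists_height_eq (h : IsSimpleDirection d v θ) (hℓ : 0 < ℓ)
    (hc : (A 1 1 : ℝ) = ℓ * Real.cos θ) (hs : (A 1 0 : ℝ) = -(ℓ * Real.sin θ)) :
    ∃ b : ℤ, sl2act A v 1 = b := by
  obtain ⟨C, hC, w, δ, hw, hδ, Φ, -, hΦr, p, hΦ⟩ := h.exists_isCylinder
  set α := sl2act A p 1 with hα
  have hne : ∀ y ∈ Ioo α (α + ℓ * δ), ∀ k : ℤ, y ≠ k ∧ y ≠ sl2act A v 1 + k := by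
    intro y hy k
    have ht : (y - α) / ℓ ∈ Ioo 0 δ :=
      ⟨div_pos (by linarith [hy.1]) hℓ, (div_lt_iff₀' hℓ).2 (by linarith [hy.2])⟩
    have := cylinder_height_ne hℓ hc hs hΦ ht k
    rwa [mul_div_cancel₀ _ hℓ.ne', ← hα, add_sub_cancel] at this
  have hcover : ∀ c : ℝ, (∀ k : ℤ, c ≠ k) → (∀ k : ℤ, c ≠ sl2act A v 1 + k) →
      ∃ m : ℤ, c + m ∈ Icc α (α + ℓ * δ) := by
    intro c hc1 hc2
    let x : Surface d v := ⟨toTorus 1 (ofCoords A 0 c), 0, fun h0 => by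
      obtain ⟨_, k, _, hk⟩ := (toTorus_one_eq_zero_iff A).1 h0
      rw [sl2act_ofCoords_one] at hk
      exact hc1 k hk, fun h0 => by
      obtain ⟨_, k, _, hk⟩ := (toTorus_one_eq_iff A).1 h0.symm
      rw [sl2act_ofCoords_one] at hk
      exact hc2 k hk⟩
    obtain ⟨C', hC', hx⟩ := h.1 x
    obtain ⟨a, rfl⟩ := h.2 C hC C' hC'
    have hsub : deck a '' C ⊆ Surface.base ⁻¹'
        {x : Torus 1 | ∃ z, toTorus 1 z = x ∧ sl2act A z 1 ∈ Icc α (α + ℓ * δ)} := by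
      rw [← hΦr]
      rintro _ ⟨_, ⟨⟨s, t⟩, rfl⟩, rfl⟩
      obtain ⟨s, rfl⟩ := QuotientAddGroup.mk_surjective s
      refine ⟨framePoint θ p s t, (hΦ s t).symm, ?_⟩
      rw [sl2act_framePoint_one hc hs]
      have h1 := mul_pos hℓ t.2.1
      have h2 := mul_lt_mul_of_pos_left t.2.2 hℓ
      constructor <;> linarith
    obtain ⟨z, hz, hzI⟩ := closure_minimal hsub
      ((isClosed_heights_Icc α (α + ℓ * δ)).preimage continuous_base) hx
    obtain ⟨_, m, _, hm⟩ := (toTorus_one_eq_iff A).1 hz.symm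
    rw [sl2act_ofCoords_one] at hm
    exact ⟨m, hm ▸ hzI⟩
  by_contra! hcon
  have hfr : 0 < Int.fract (sl2act A v 1) :=
    lt_of_le_of_ne (Int.fract_nonneg _) fun h0 => hcon ⌊sl2act A v 1⌋
      (by linarith [Int.floor_add_fract (sl2act A v 1)])
  have hfr1 := Int.fract_lt_one (sl2act A v 1)
  have hk1 := Int.floor_le α
  have hk2 := Int.lt_floor_add_one α
  have htop : α + ℓ * δ ≤ ⌊α⌋ + 1 := by
    by_contra! hlt
    exact (hne (⌊α⌋ + 1) ⟨hk2, hlt⟩ (⌊α⌋ + 1)).1 (by push_cast; rfl)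
  have hcast : ∀ {m n : ℤ}, (m : ℝ) < n → (m : ℝ) + 1 ≤ n := fun h => by exact_mod_cast h
  -- `β` is the translate of the height of `v` in `(⌊α⌋, ⌊α⌋ + 1)`; the cylinder lies entirely above
  -- or entirely below it.
  set β : ℝ := ⌊α⌋ + Int.fract (sl2act A v 1) with hβ
  have hβv : sl2act A v 1 = β + ((⌊sl2act A v 1⌋ - ⌊α⌋ : ℤ) : ℝ) := by
    push_cast
    linarith [Int.floor_add_fract (sl2act A v 1)]
  have hne_int : ∀ c : ℝ, (⌊α⌋ : ℝ) < c → c < ⌊α⌋ + 1 → ∀ k : ℤ, c ≠ k := by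
    rintro _ h1 h2 k rfl
    linarith [hcast h1]
  rcases le_or_gt β α with hle | hlt
  -- Cylinder above `β`: probe the midpoint of the lower arc.
  · obtain ⟨m, hm⟩ := hcover ((⌊α⌋ + β) / 2) (hne_int _ (by linarith) (by linarith))
      fun k hk => by
        rw [hβv] at hk
        refine hne_int ((⌊α⌋ + β) / 2 - β + ⌊α⌋ + 1) (by linarith) (by linarith)
          (⌊sl2act A v 1⌋ - ⌊α⌋ + k + ⌊α⌋ + 1) ?_
        push_cast at hk ⊢
        linarith
    have hm0 : ((0 : ℤ) : ℝ) < m := by rw [Int.cast_zero]; linarith [hm.1]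
    have hm1 := hcast hm0
    rw [Int.cast_zero] at hm1
    linarith [hm.2]
  · have htop' : α + ℓ * δ ≤ β := by
      by_contra! hlt'
      refine (hne β ⟨hlt, hlt'⟩ (-(⌊sl2act A v 1⌋ - ⌊α⌋))).2 ?_
      rw [Int.cast_neg]
      linarith
    -- Cylinder below `β`: probe the midpoint of the upper arc.
    obtain ⟨m, hm⟩ := hcover ((β + (⌊α⌋ + 1)) / 2) (hne_int _ (by linarith) (by linarith))
      fun k hk => by
        rw [hβv] at hk
        refine hne_int ((β + (⌊α⌋ + 1)) / 2 - β + ⌊α⌋) (by linarith) (by linarith)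
          (⌊sl2act A v 1⌋ - ⌊α⌋ + k + ⌊α⌋) ?_
        push_cast at hk ⊢
        linarith
    have hm0 : (m : ℝ) < (0 : ℤ) := by rw [Int.cast_zero]; linarith [hm.2]
    have hm1 := hcast hm0
    rw [Int.cast_zero] at hm1
    linarith [hm.1]

theorem toTorus_mem_topBoundary_iff {z : Fin 2 → ℝ} {m : ZMod d} :
    toTorus d z ∈ topBoundary d (m - 1) ↔ ∃ b : ℤ, z 1 = b ∧ (b : ZMod d) = m := by
  constructor
  · rintro ⟨z', a, h, ha, hz'⟩
    obtain ⟨c, hc⟩ := toTorus_eq_iff.1 h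
    refine ⟨a + 1 + d * c 1, ?_, ?_⟩
    · rw [hc, hz']
      push_cast
      ring
    · push_cast
      rw [ha]
      simp
  · rintro ⟨b, hz, rfl⟩
    exact ⟨z, b - 1, rfl, by push_cast; ring, by rw [hz]; push_cast; ring⟩

theorem exists_isSimpleDirection_iff [NeZero d] (v : Fin 2 → ℝ) (k : ℕ) :
    (∃ θ : ℝ, IsSimpleDirection d v θ ∧ (cylinders d v θ).encard = (k : ℕ∞)) ↔
      ∃ (A : Matrix.SpecialLinearGroup (Fin 2) ℤ) (m : ZMod d),
        toTorus d (sl2act A v) ∈ topBoundary d (m - 1) ∧ k = Nat.gcd m.val d := by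
  constructor
  · rintro ⟨θ, h, hk⟩
    obtain ⟨C, _, hC⟩ := h.exists_isCylinder
    obtain ⟨A, ℓ, hℓ, hc, hs⟩ := hC.exists_sl2
    obtain ⟨b, hb⟩ := h.exists_height_eq hℓ hc hs
    rw [encard_cylinders hb hℓ hc hs] at hk
    exact ⟨A, b, toTorus_mem_topBoundary_iff.2 ⟨b, hb, rfl⟩, by exact_mod_cast hk.symm⟩
  · rintro ⟨A, m, h, rfl⟩
    obtain ⟨b, hb, rfl⟩ := toTorus_mem_topBoundary_iff.1 h
    -- The vector sent to `(1, 0)` by `A`; its argument is the direction and its norm is `ℓ`.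
    let e : ℂ := ⟨A 1 1, -A 1 0⟩
    have he : e ≠ 0 := by
      intro h0
      have h1 : (A 1 1 : ℝ) = 0 := congrArg Complex.re h0
      have h2 : -(A 1 0 : ℝ) = 0 := congrArg Complex.im h0
      have := entries_det_real A
      rw [h1, neg_eq_zero.1 h2] at this
      norm_num at this
    have hc : (A 1 1 : ℝ) = ‖e‖ * Real.cos e.arg := (Complex.norm_mul_cos_arg e).symm
    have hs : (A 1 0 : ℝ) = -(‖e‖ * Real.sin e.arg) := by
      rw [Complex.norm_mul_sin_arg]
      exact (neg_neg _).symm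
    exact ⟨e.arg, isSimpleDirection_of_height_eq hb (norm_pos_iff.2 he) hc hs,
      encard_cylinders hb (norm_pos_iff.2 he) hc hs⟩

/-! ### Torsion points -/

theorem nsmul_toTorus_eq_zero_iff {n : ℕ} :
    n • toTorus d v = 0 ↔ ∃ a : Fin 2 → ℤ, ∀ i, n * v i = d * a i := by
  rw [toTorus, ← QuotientAddGroup.mk_nsmul, QuotientAddGroup.eq_zero_iff]
  constructor
  · rintro ⟨a, ha⟩
    exact ⟨a, fun i => by simpa using ha i⟩
  · rintro ⟨a, ha⟩
    exact ⟨a, fun i => by simpa using ha i⟩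

/-- Make the second entry nonzero, then add to `a` the multiple of `n` by the product of those
primes of the second entry that do not divide `a`. A common prime not dividing `a` would divide this
product, hence `a`; one dividing `a` would divide `n` and `c`, or be a prime of the product. -/
theorem exists_isCoprime_add_mul {a c n : ℤ} (hn : n ≠ 0)
    (h : ∀ p : ℕ, p.Prime → (p : ℤ) ∣ a → (p : ℤ) ∣ c → ¬ (p : ℤ) ∣ n) :
    ∃ i j : ℤ, IsCoprime (a + n * i) (c + n * j) := by
  obtain ⟨j, hj⟩ : ∃ j : ℤ, c + n * j ≠ 0 := by
    by_cases hc : c = 0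
    · exact ⟨1, by simpa [hc] using hn⟩
    · exact ⟨0, by simpa using hc⟩
  refine ⟨∏ p ∈ (c + n * j).natAbs.primeFactors.filter fun p : ℕ => ¬ (p : ℤ) ∣ a, (p : ℤ), j, ?_⟩
  rw [Int.isCoprime_iff_gcd_eq_one]
  by_contra hg
  obtain ⟨p, hp, hpg⟩ := Nat.exists_prime_and_dvd hg
  have hpg' : (p : ℤ) ∣ _ := Int.natCast_dvd_natCast.2 hpg
  have h1 := hpg'.trans (Int.gcd_dvd_left ..)
  have h2 := hpg'.trans (Int.gcd_dvd_right ..)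
  by_cases hpa : (p : ℤ) ∣ a
  · have h3 := (dvd_add_right hpa).1 h1
    rcases (Nat.prime_iff_prime_int.1 hp).dvd_or_dvd h3 with h4 | h4
    · exact h p hp hpa ((dvd_add_left (h4.mul_right j)).1 h2) h4
    · obtain ⟨q, hq, hpq⟩ := (Nat.prime_iff_prime_int.1 hp).exists_mem_finset_dvd h4
      rw [Finset.mem_filter, Nat.mem_primeFactors] at hq
      have := (Nat.prime_dvd_prime_iff_eq hp hq.1.1).1 (Int.natCast_dvd_natCast.1 hpq)
      exact hq.2 (this ▸ hpa)
  · refine hpa ((dvd_add_left (Dvd.dvd.mul_left ?_ n)).1 h1)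
    refine Finset.dvd_prod_of_mem (fun p : ℕ => (p : ℤ)) ?_
    rw [Finset.mem_filter, Nat.mem_primeFactors]
    exact ⟨⟨hp, Int.natCast_dvd.1 h2, Int.natAbs_ne_zero.2 hj⟩, hpa⟩

theorem gcd_val_intCast [NeZero d] (b : ℤ) : Nat.gcd (b : ZMod d).val d = Int.gcd b d := by
  have h : (((b : ZMod d).val : ℤ)) = b % d := ZMod.val_intCast b
  rw [← Int.gcd_natCast_natCast, h, Int.emod_def, Int.gcd_sub_mul_left_left]

/-- Write `v = (d / n) a` with `n = d' * n'`. Exact order `n` makes `a 0`, `a 1`, `n` jointly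
coprime, so `a` is congruent modulo `n` to a primitive `a'` with `x a'₀ + y a'₁ = 1`. The row `(n' x
- a'₁, n' y + a'₀)` pairs with `a'` to `n'`, hence with `(d / n) a'` to `g`; replacing `a'` by `a`
costs a multiple of `d`. -/
theorem exists_height_of_addOrderOf {n g d' : ℕ} (hn : 0 < n)
    (hv : addOrderOf (toTorus d v) = n) (hd : d = d' * g) (hdvd : d' ∣ n) :
    ∃ (A : Matrix.SpecialLinearGroup (Fin 2) ℤ) (M : ℤ),
      sl2act A v 1 = ((g - d * M : ℤ) : ℝ) := by
  obtain ⟨a, ha⟩ := nsmul_toTorus_eq_zero_iff.1 (hv ▸ addOrderOf_nsmul_eq_zero (toTorus d v))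
  obtain ⟨n', rfl⟩ := hdvd
  obtain ⟨i, j, x, y, hxy⟩ := exists_isCoprime_add_mul (a := a 0) (c := a 1)
    (n := (d' * n' : ℕ)) (by exact_mod_cast hn.ne') fun p hp h0 h1 h2 => by
      obtain ⟨r, hr⟩ := Int.natCast_dvd_natCast.1 h2
      obtain ⟨a0, h0⟩ := h0
      obtain ⟨a1, h1⟩ := h1
      have hp0 : (p : ℝ) ≠ 0 := Nat.cast_ne_zero.2 hp.ne_zero
      have hz : r • toTorus d v = 0 := by
        refine nsmul_toTorus_eq_zero_iff.2 ⟨![a0, a1], fun i => mul_left_cancel₀ hp0 ?_⟩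
        have hai := ha i
        rw [hr] at hai
        push_cast at hai
        fin_cases i
        · simp only [Fin.zero_eta, h0, Matrix.cons_val_zero] at hai ⊢
          push_cast at hai
          linarith
        · simp only [Fin.mk_one, h1, Matrix.cons_val_one, Matrix.cons_val_fin_one] at hai ⊢
          push_cast at hai
          linarith
      have hdvd := addOrderOf_dvd_of_nsmul_eq_zero hz
      rw [hv, hr] at hdvd
      have hr0 : 0 < r := Nat.pos_of_mul_pos_left (hr ▸ hn)
      have := Nat.le_of_dvd hr0 hdvd
      nlinarith [hp.two_le]
  obtain ⟨A, hA0, hA1⟩ : ∃ A : Matrix.SpecialLinearGroup (Fin 2) ℤ,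
      A 1 0 = n' * x - (a 1 + (d' * n' : ℕ) * j) ∧ A 1 1 = n' * y + (a 0 + (d' * n' : ℕ) * i) :=
    -- Bézout coefficients `(-y, x)`: the terms in `n'` cancel, leaving `x a'₀ + y a'₁ = 1`.
    IsCoprime.exists_SL2_row ⟨-y, x, by linear_combination hxy⟩ 1
  refine ⟨A, i * A 1 0 + j * A 1 1, ?_⟩
  have hn0 : ((d' * n' : ℕ) : ℝ) ≠ 0 := by exact_mod_cast hn.ne'
  have hxy' : (x * (a 0 + (d' * n' : ℕ) * i) + y * (a 1 + (d' * n' : ℕ) * j) : ℝ) = 1 := by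
    exact_mod_cast hxy
  have ha0 := ha 0
  have ha1 := ha 1
  apply mul_left_cancel₀ hn0
  rw [sl2act_one, hA0, hA1]
  have hd' : (d : ℝ) = d' * g := by exact_mod_cast hd
  push_cast at ha0 ha1 hxy' ⊢
  linear_combination (n' * x - (a 1 + d' * n' * j) : ℝ) * ha0 +
    (n' * y + (a 0 + d' * n' * i) : ℝ) * ha1 + (d * n' : ℝ) * hxy' + (n' : ℝ) * hd'

theorem exists_mem_topBoundary_iff_of_isOfFinAddOrder [NeZero d] {v : Fin 2 → ℝ} (k : ℕ)
    (hv : IsOfFinAddOrder (toTorus d v)) :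
    (∃ (A : Matrix.SpecialLinearGroup (Fin 2) ℤ) (m : ZMod d),
        toTorus d (sl2act A v) ∈ topBoundary d (m - 1) ∧ k = Nat.gcd m.val d) ↔
      ∃ m : ZMod d, k = Nat.gcd m.val d ∧
        ∃ n : ℕ, d / Nat.gcd d m.val ∣ n ∧ toTorus d v ∈ torsionOfOrder d n := by
  constructor
  · rintro ⟨A, m, h, hk⟩
    obtain ⟨b, hb, rfl⟩ := toTorus_mem_topBoundary_iff.1 h
    refine ⟨b, hk, _, ?_, hv.addOrderOf_pos, rfl⟩
    -- `d / gcd(d, m)` is the additive order of `m` in `ℤ/d`, so the divisibility says that the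
    -- order of `[v]` kills `b`.
    rw [← ZMod.addOrderOf_coe _ (NeZero.ne d), ZMod.natCast_zmod_val,
      addOrderOf_dvd_iff_nsmul_eq_zero]
    obtain ⟨a, ha⟩ := nsmul_toTorus_eq_zero_iff.1 (addOrderOf_nsmul_eq_zero (toTorus d v))
    have h1 : ((addOrderOf (toTorus d v) * b : ℤ) : ℝ) =
        ((d * (A 1 0 * a 0 + A 1 1 * a 1) : ℤ) : ℝ) := by
      push_cast
      rw [← hb, sl2act_one]
      linear_combination (A 1 0 : ℝ) * ha 0 + (A 1 1 : ℝ) * ha 1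
    have h2 := congrArg (Int.cast : ℤ → ZMod d) (Int.cast_injective h1)
    push_cast at h2
    rw [nsmul_eq_mul, h2]
    simp
  · rintro ⟨m, rfl, n, hdvd, hn, hord⟩
    have hd : d = d / Nat.gcd d m.val * Nat.gcd d m.val :=
      (Nat.div_mul_cancel (Nat.gcd_dvd_left _ _)).symm
    obtain ⟨A, M, hA⟩ := exists_height_of_addOrderOf hn hord hd hdvd
    refine ⟨A, _, toTorus_mem_topBoundary_iff.2 ⟨_, hA, rfl⟩, ?_⟩
    rw [gcd_val_intCast, Int.gcd_sub_mul_left_left, Int.gcd_natCast_natCast,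
      Nat.gcd_eq_left (Nat.gcd_dvd_left _ _), Nat.gcd_comm]

end DSym

theorem mainTheorem8 (d : ℕ) (hd : 1 ≤ d) (v : Fin 2 → ℝ) (k : ℕ) :
    ((∃ θ : ℝ, DSym.IsSimpleDirection d v θ ∧ (DSym.cylinders d v θ).encard = (k : ℕ∞)) ↔
      (∃ (A : Matrix.SpecialLinearGroup (Fin 2) ℤ) (m : ZMod d),
        DSym.toTorus d (DSym.sl2act A v) ∈ DSym.topBoundary d (m - 1) ∧
          k = Nat.gcd m.val d)) ∧
    (IsOfFinAddOrder (DSym.toTorus d v) →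
      ((∃ (A : Matrix.SpecialLinearGroup (Fin 2) ℤ) (m : ZMod d),
        DSym.toTorus d (DSym.sl2act A v) ∈ DSym.topBoundary d (m - 1) ∧
          k = Nat.gcd m.val d) ↔
      (∃ m : ZMod d, k = Nat.gcd m.val d ∧
        ∃ n : ℕ, d / Nat.gcd d m.val ∣ n ∧
          DSym.toTorus d v ∈ DSym.torsionOfOrder d n))) := by
  have : NeZero d := ⟨by omega⟩
  exact ⟨DSym.exists_isSimpleDirection_iff v k,
    DSym.exists_mem_topBoundary_iff_of_isOfFinAddOrder k⟩
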